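/- Let $G=(V,E)$ be a finite simple undirected graph on $n\ge 2$ vertices $V=\{v_1,\dots,v_n\}$ that is a triangulated Laman graph: every cycle of $G$ of length greater than $3$ has a chord (an edge joining two nonconsecutive vertices of the cycle), and $G$ is minimally rigid in the plane, i.e. $G$ is generically rigid in $\mathbb{R}^2$ (it has an infinitesimally rigid placement in $\mathbb{R}^2$) and loses this property when any edge is removed. Then $G$ has exactly $n-2$ triangles $\Delta_1,\dots,\Delta_{n-2}$. Let the derived graph $D_G$ be the graph whose nodes are these triangles, two distinct triangles being adjacent if and only if they share an edge of $G$. For each triangle $\Delta_i$ let $(a_{i,j})_{v_j\in\Delta_i}$ be nonnegative weights with $\sum_{v_j\in\Delta_i}a_{i,j}=1$, and let $$A_i=\sum_{v_j,v_k\in\Delta_i}a_{i,k}\,e_je_k^\top+\sum_{v_j\notin\Delta_i}e_je_j^\top\in\mathbb{R}^{n\times n}$$ be the corresponding local stochastic matrix. Assume that $a_{i,j}+a_{i,k}>0$ whenever $(v_j,v_k)$ is an edge of $\Delta_i$ that also belongs to a triangle other than $\Delta_i$. Then there exist $n-2$ probability vectors $\overline w_1,\dots,\overline w_{n-2}\in\mathbb{R}^n$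 such that, for every $i$ and every infinite walk $\gamma=\Delta_{i_1}\Delta_{i_2}\Delta_{i_3}\cdots$ in $D_G$ that starts at $\Delta_{i_1}=\Delta_i$ and visits every node of $D_G$ infinitely often, $$\lim_{t\to\infty}A_{i_t}\cdots A_{i_2}A_{i_1}=\mathbf 1\,\overline w_i^\top .$$ In particular the limit depends only on the starting triangle. -/

import Mathlib

open Filter Topology

noncomputable section

namespace TLG

variable {V : Type*}

/-! ### Plane rigidity -/

/-- A placement of the vertices in the Euclidean plane. -/
abbrev Placement (V : Type*) := V → EuclideanSpace ℝ (Fin 2)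

/-- `u` is an infinitesimal motion of the framework `(G, p)`: to first order, moving every vertex
`x` with velocity `u x` preserves the length of every edge. -/
def IsInfinitesimalMotion (G : SimpleGraph V) (p u : Placement V) : Prop :=
  ∀ x y, G.Adj x y → inner ℝ (p x - p y) (u x - u y) = 0

/-- `u` is trivial: it is the velocity field, at the points `p x`, of a rigid motion of the plane
(a translation with velocity `c` combined with a rotation with angular velocity `ω`). -/
def IsTrivialMotion (p u : Placement V) : Prop :=
  ∃ (ω : ℝ) (c : EuclideanSpace ℝ (Fin 2)),
    ∀ x, u x 0 = c 0 - ω * p x 1 ∧ u x 1 = c 1 + ω * p x 0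

/-- The framework `(G, p)` is infinitesimally rigid. -/
def IsInfinitesimallyRigid (G : SimpleGraph V) (p : Placement V) : Prop :=
  ∀ u, IsInfinitesimalMotion G p u → IsTrivialMotion p u

/-- `G` is (generically) rigid in the plane: it has an infinitesimally rigid placement.
The infinitesimally rigid placements form a Zariski open set, so if there is one then every generic
placement is infinitesimally rigid. -/
def IsRigid (G : SimpleGraph V) : Prop :=
  ∃ p : Placement V, IsInfinitesimallyRigid G p

/-- `G` is minimally rigid: it is rigid, and no edge can be removed without losing rigidity. -/
def IsMinimallyRigid (G : SimpleGraph V) : Prop :=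
  IsRigid G ∧ ∀ e ∈ G.edgeSet, ¬ IsRigid (G.deleteEdges {e})

/-! ### Triangulated Laman graphs and their derived graphs -/

/-- Every cycle of length greater than `3` has a chord, that is, an edge of `G` joining two
nonconsecutive vertices of the cycle. -/
def IsTriangulated (G : SimpleGraph V) : Prop :=
  ∀ (v : V) (c : G.Walk v v), c.IsCycle → 3 < c.length →
    ∃ x ∈ c.support, ∃ y ∈ c.support, G.Adj x y ∧ s(x, y) ∉ c.edges

/-- A triangulated Laman graph. -/
structure IsTriangulatedLaman (G : SimpleGraph V) : Prop where
  triangulated : IsTriangulated G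
  minimallyRigid : IsMinimallyRigid G

/-- The triangles of `G`, as sets of three pairwise adjacent vertices. -/
abbrev Triangle (G : SimpleGraph V) := {Δ : Finset V // G.IsNClique 3 Δ}

/-- The derived graph: its nodes are the triangles of `G`, and two distinct triangles are adjacent
when they share an edge of `G`. -/
def derivedGraph (G : SimpleGraph V) : SimpleGraph (Triangle G) where
  Adj Δ Δ' := Δ ≠ Δ' ∧ ∃ x y, G.Adj x y ∧ x ∈ Δ.1 ∧ y ∈ Δ.1 ∧ x ∈ Δ'.1 ∧ y ∈ Δ'.1
  symm := ⟨fun _ _ ⟨hne, x, y, hxy, h1, h2, h3, h4⟩ => ⟨hne.symm, x, y, hxy, h3, h4, h1, h2⟩⟩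
  loopless := ⟨fun _ h => h.1 rfl⟩

/-! ### Local stochastic matrices and their products -/

/-- `a Δ v` is the weight of the vertex `v` in the triangle `Δ`. Only the values at the three
vertices of `Δ` matter; they are nonnegative and sum to `1`. -/
def IsLocalWeight {G : SimpleGraph V} (a : Triangle G → V → ℝ) : Prop :=
  ∀ Δ : Triangle G, (∀ v ∈ Δ.1, 0 ≤ a Δ v) ∧ ∑ v ∈ Δ.1, a Δ v = 1

/-- In every triangle, the endpoints of an edge that also belongs to another triangle (a nonsimple
edge) have a positive total weight. -/
def IsPositiveOnNonsimpleEdges {G : SimpleGraph V} (a : Triangle G → V → ℝ) : Prop :=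
  ∀ (Δ : Triangle G), ∀ x ∈ Δ.1, ∀ y ∈ Δ.1, x ≠ y →
    (∃ Δ' : Triangle G, Δ' ≠ Δ ∧ x ∈ Δ'.1 ∧ y ∈ Δ'.1) → 0 < a Δ x + a Δ y

/-- The local stochastic matrix of the triangle `Δ`: its principal submatrix on `Δ` has three rows
equal to the local weight vector of `Δ`, and the remainder of the matrix is the identity. -/
def localMatrix [DecidableEq V] {G : SimpleGraph V} (a : Triangle G → V → ℝ) (Δ : Triangle G) :
    Matrix V V ℝ :=
  Matrix.of fun i j =>
    if i ∈ Δ.1 then (if j ∈ Δ.1 then a Δ j else 0) else (if i = j then 1 else 0)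

/-- An infinite walk `γ 0, γ 1, γ 2, …` in a graph. -/
def IsInfiniteWalk {W : Type*} (D : SimpleGraph W) (γ : ℕ → W) : Prop :=
  ∀ t, D.Adj (γ t) (γ (t + 1))

/-- The sequence `γ` visits every node infinitely often. -/
def IsExhaustive {W : Type*} (γ : ℕ → W) : Prop :=
  ∀ Δ, ∃ᶠ t in atTop, γ t = Δ

/-- The product of the matrices of the first `t` nodes of `γ`, the first node standing on the right:
`A (γ (t - 1)) * ⋯ * A (γ 1) * A (γ 0)`. -/
def partialProduct [Fintype V] [DecidableEq V] {W : Type*} (A : W → Matrix V V ℝ) (γ : ℕ → W) :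
    ℕ → Matrix V V ℝ
  | 0 => 1
  | t + 1 => A (γ t) * partialProduct A γ t

end TLG

end

/-!
The rigidity hypothesis enters only through two facts. A minimally rigid graph has no `K₄`: the
affine dependence of four points of the plane gives an equilibrium stress of the `K₄`, so one of its
edges is redundant (`IsMinimallyRigid.cliqueFree_four`). A rigid graph has at least `2 * n - 3` edges
(`IsRigid.two_mul_card_le`). By Dirac's lemma (`IsTriangulated.exists_simplicial`), a chordal graph
can be dismantled by removing simplicial vertices; without `K₄` each of them has degree at most two,
and the number of edges forces the degree to be exactly two. So the graph is a 2-tree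
(`IsTriangulatedLaman.isTwoTree`), and each new vertex creates exactly one triangle.

By induction along the 2-tree one finds for every triangle `Δ` a nonzero measure `w Δ` on the
vertices, proportional to the local weights on `Δ`, such that for two triangles with a common edge
the measures agree outside the edge and have the same total on it (`IsTwoTree.exists_isBalanced`).
After the averaging over `Δ` the state is constant on `Δ`, so the integral of the state is the same
under `w Δ` and under the measure of the next triangle of the walk; and averaging over `Δ` preserves
the integral under `w Δ`. Hence the integral of the state under the measure of the current triangle
is conserved, and depends only on the first triangle and the initial state.

In the same way the second moment of the state under the measure of the current triangle decreases,
at each step at least by a constant times the square of the difference between consecutive local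
means. These differences therefore tend to zero (`IsBalanced.eventually_abs_sub_le`). This does not
bound their sum, and the walk may take arbitrarily long to visit all triangles; but the spread of
the values on the vertices visited since a given time can grow only when a new vertex is visited,
hence at most `n` times (`exists_forall_visited_mem_Icc`). So the state converges to a constant
vector, and the conserved integral identifies the constant (`IsBalanced.tendsto_walk`).
-/

namespace TLG

variable {V : Type*}

/-! ### Rigidity: no `K₄`, and many edges -/

/-- A graph that is minimally rigid in the plane contains no `K₄`. Four points of the plane have an
affine dependence `l`, and `l i * l j` is then an equilibrium stress of the `K₄` they span, so an
edge with nonzero stress can be removed without losing rigidity. -/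
theorem IsMinimallyRigid.cliqueFree_four {G : SimpleGraph V} (hG : IsMinimallyRigid G) :
    G.CliqueFree 4 := by
  classical
  intro s hs
  obtain ⟨⟨p, hp⟩, hmin⟩ := hG
  let T : (s → ℝ) →ₗ[ℝ] ℝ × EuclideanSpace ℝ (Fin 2) :=
    (∑ i, LinearMap.proj i).prod (∑ i : s, (LinearMap.proj i).smulRight (p i))
  have hker : LinearMap.ker T ≠ ⊥ := by
    apply LinearMap.ker_ne_bot_of_finrank_lt
    simp [hs.card_eq]
  obtain ⟨l, hl, hl0⟩ := (Submodule.ne_bot_iff _).1 hker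
  have hT : T l = (∑ i, l i, ∑ i, l i • p i) := by
    simp [T]
  rw [LinearMap.mem_ker, hT, Prod.mk_eq_zero] at hl
  obtain ⟨hsum, hmom⟩ := hl
  obtain ⟨i, hi⟩ : ∃ i, l i ≠ 0 := by
    by_contra! h
    exact hl0 (funext h)
  obtain ⟨j, hji, hj⟩ : ∃ j, j ≠ i ∧ l j ≠ 0 := by
    by_contra! h
    rw [Finset.sum_eq_single i (fun j _ hj => h j hj) (by simp)] at hsum
    exact hi hsum
  have hadj : ∀ a b : s, a ≠ b → G.Adj a b := fun a b hab =>
    hs.isClique a.2 b.2 (fun h => hab (Subtype.ext h))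
  refine hmin s((i : V), (j : V)) (hadj i j hji.symm) ⟨p, fun u hu => hp u ?_⟩
  have key : ∑ a, ∑ b, l a * l b * inner ℝ (p a - p b) (u a - u b) = 0 := by
    have h1 : ∑ a, ∑ b, l a * l b * inner ℝ (p a) (u b)
        = inner ℝ (∑ a, l a • p a) (∑ b, l b • u b) := by
      rw [sum_inner]
      refine Finset.sum_congr rfl fun a _ => ?_
      rw [inner_sum]
      refine Finset.sum_congr rfl fun b _ => ?_
      rw [real_inner_smul_left, real_inner_smul_right, mul_assoc]
    have h2 : ∑ a, ∑ b, l a * l b * inner ℝ (p b) (u a)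
        = inner ℝ (∑ a, l a • p a) (∑ b, l b • u b) := by
      refine Finset.sum_comm.trans (Eq.trans ?_ h1)
      exact Finset.sum_congr rfl fun a _ => Finset.sum_congr rfl fun b _ => by ring
    have h3 : ∑ a, ∑ b, l a * l b * inner ℝ (p a) (u a) = 0 := by
      have : ∀ a, ∑ b, l a * l b * inner ℝ (p a) (u a)
          = (∑ b, l b) * (l a * inner ℝ (p a) (u a)) := fun a => by
        rw [Finset.sum_mul]
        exact Finset.sum_congr rfl fun b _ => by ring
      simp only [this, hsum, zero_mul, Finset.sum_const_zero]
    have h4 : ∑ a, ∑ b, l a * l b * inner ℝ (p b) (u b) = 0 := by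
      refine Finset.sum_comm.trans (Eq.trans ?_ h3)
      exact Finset.sum_congr rfl fun a _ => Finset.sum_congr rfl fun b _ => by ring
    simp only [inner_sub_left, inner_sub_right, mul_sub, Finset.sum_sub_distrib, h1, h2, h3, h4,
      hmom, inner_zero_left, sub_zero]
  have hzero : ∀ a b : s, s((a : V), (b : V)) ≠ s((i : V), (j : V)) →
      l a * l b * inner ℝ (p a - p b) (u a - u b) = 0 := by
    intro a b hab
    by_cases h : a = b
    · simp [h]
    · rw [hu a b, mul_zero]
      rw [SimpleGraph.deleteEdges_adj]
      exact ⟨hadj a b h, hab⟩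
  -- Only the two orderings of the pair `i, j` contribute to the sum.
  have hij : inner ℝ (p i - p j) (u i - u j) = 0 := by
    have hi' : ∑ b, l i * l b * inner ℝ (p i - p b) (u i - u b)
        = l i * l j * inner ℝ (p i - p j) (u i - u j) := by
      refine Finset.sum_eq_single j (fun b _ hb => hzero i b ?_) (by simp)
      exact fun h => hb (Subtype.ext (Sym2.congr_right.1 h))
    have hj' : ∑ b, l j * l b * inner ℝ (p j - p b) (u j - u b)
        = l j * l i * inner ℝ (p j - p i) (u j - u i) := by
      refine Finset.sum_eq_single i (fun b _ hb => hzero j b ?_) (by simp)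
      exact fun h => hb (Subtype.ext (Sym2.congr_right.1 (h.trans Sym2.eq_swap)))
    rw [Finset.sum_eq_add i j hji.symm, hi', hj', ← neg_sub (p i), ← neg_sub (u i),
      inner_neg_neg] at key
    · have : (l i * l j) * inner ℝ (p i - p j) (u i - u j) = 0 := by linarith
      exact (mul_eq_zero.1 this).resolve_left (mul_ne_zero hi hj)
    · rintro a - ⟨hai, haj⟩
      refine Finset.sum_eq_zero fun b _ => hzero a b ?_
      have h1 : (a : V) ≠ i := fun h => hai (Subtype.ext h)
      have h2 : (a : V) ≠ j := fun h => haj (Subtype.ext h)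
      simp [h1, h2]
    · simp
    · simp
  intro x y hxy
  by_cases h : s(x, y) = s((i : V), (j : V))
  · rcases Sym2.eq_iff.1 h with ⟨rfl, rfl⟩ | ⟨rfl, rfl⟩
    · exact hij
    · rw [← neg_sub (p i), ← neg_sub (u i), inner_neg_neg, hij]
  · refine hu x y ?_
    rw [SimpleGraph.deleteEdges_adj]
    exact ⟨hxy, h⟩

/-- A rigid graph on `n` vertices has at least `2 * n - 3` edges: its infinitesimal motions are cut
out by one linear equation for each edge, and they all lie in the space of trivial motions, of
dimension at most `3`. -/
theorem IsRigid.two_mul_card_le [Fintype V] {G : SimpleGraph V} [DecidableRel G.Adj]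
    (hG : IsRigid G) : 2 * Fintype.card V ≤ G.edgeFinset.card + 3 := by
  classical
  obtain ⟨p, hp⟩ := hG
  let π : V → Placement V →ₗ[ℝ] EuclideanSpace ℝ (Fin 2) := fun v => LinearMap.proj v
  let R : Placement V →ₗ[ℝ] (G.edgeSet → ℝ) := LinearMap.pi fun e =>
    (innerSL ℝ (p e.1.out.1 - p e.1.out.2)).toLinearMap ∘ₗ
      (π e.1.out.1 - π e.1.out.2)
  let T : (Fin 3 → ℝ) →ₗ[ℝ] Placement V :=
    { toFun := fun c x => !₂[c 0 - c 2 * p x 1, c 1 + c 2 * p x 0]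
      map_add' := fun c d => by
        ext x k
        fin_cases k <;> simp <;> ring
      map_smul' := fun r c => by
        ext x k
        fin_cases k <;> simp <;> ring }
  have hRT : LinearMap.ker R ≤ LinearMap.range T := by
    intro u hu
    obtain ⟨ω, c, h⟩ := hp u fun x y hxy => by
      have h := congr_fun (LinearMap.mem_ker.1 hu) ⟨s(x, y), hxy⟩
      have hout : s((s(x, y)).out.1, (s(x, y)).out.2) = s(x, y) := Quot.out_eq _
      simp only [R, π, LinearMap.pi_apply, LinearMap.comp_apply, LinearMap.sub_apply,
        LinearMap.proj_apply, ContinuousLinearMap.coe_coe, innerSL_apply_apply, Pi.zero_apply] at h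
      rcases Sym2.eq_iff.1 hout with ⟨h1, h2⟩ | ⟨h1, h2⟩
      · rwa [h1, h2] at h
      · rwa [h1, h2, ← neg_sub (p x), ← neg_sub (u x), inner_neg_neg] at h
    refine ⟨![c 0, c 1, ω], ?_⟩
    ext x k
    fin_cases k
    · simp [T, (h x).1]
    · simp [T, (h x).2]
  have h1 := Submodule.finrank_mono hRT
  have h2 := LinearMap.finrank_range_add_finrank_ker R
  have h3 := LinearMap.finrank_range_le T
  have h4 := Submodule.finrank_le (LinearMap.range R)
  have h5 : Module.finrank ℝ (Placement V) = 2 * Fintype.card V := by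
    simp [Placement, Module.finrank_pi_fintype, mul_comm]
  have h6 : Fintype.card G.edgeSet = G.edgeFinset.card := (Set.toFinset_card _).symm
  simp only [Module.finrank_fintype_fun_eq_card, Fintype.card_fin] at h3 h4
  omega

/-! ### Chordal graphs have simplicial vertices -/

/-- In a chordal graph, two neighbours `x`, `y` of `v` joined by a walk whose inner vertices are
outside the closed neighbourhood of `v` are adjacent. Otherwise a shortest such walk would close up
through `v` to a cycle, any chord of which gives a shorter walk. -/
theorem IsTriangulated.adj_of_walk {G : SimpleGraph V} (hG : IsTriangulated G) {v x y : V}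
    (hx : G.Adj v x) (hy : G.Adj v y) (hxy : x ≠ y) (p : G.Walk x y)
    (hp : ∀ z ∈ p.support, z = x ∨ z = y ∨ (z ≠ v ∧ ¬ G.Adj v z)) : G.Adj x y := by
  classical
  induction hn : p.length using Nat.strong_induction_on generalizing p with
  | _ n ih =>
  subst hn
  by_cases hlt : ∃ q : G.Walk x y, q.length < p.length ∧ q.support ⊆ p.support
  · obtain ⟨q, hq, hqs⟩ := hlt
    exact ih _ hq q (fun z hz => hp z (hqs hz)) rfl
  have hpath : p.IsPath := by
    rw [← p.bypass_eq_self_of_length_le_length_bypass (by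
      by_contra! h
      exact hlt ⟨p.bypass, h, p.support_bypass_subset_support⟩)]
    exact p.bypass_isPath
  have hvp : v ∉ p.support := fun h => by
    rcases hp v h with rfl | rfl | h
    · exact G.loopless.irrefl _ hx
    · exact G.loopless.irrefl _ hy
    · exact h.1 rfl
  by_cases hlen : p.length ≤ 1
  · interval_cases h : p.length
    · exact absurd (SimpleGraph.Walk.eq_of_length_eq_zero h) hxy
    · exact SimpleGraph.Walk.adj_of_length_eq_one h
  exfalso
  have hcyc : (SimpleGraph.Walk.cons hx (p.concat hy.symm)).IsCycle := by
    rw [SimpleGraph.Walk.cons_isCycle_iff]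
    refine ⟨hpath.concat hvp hy.symm, fun h => ?_⟩
    rw [SimpleGraph.Walk.edges_concat, List.concat_eq_append, List.mem_append,
      List.mem_singleton] at h
    rcases h with h | h
    · exact hvp (SimpleGraph.Walk.fst_mem_support_of_mem_edges p h)
    · rcases Sym2.eq_iff.1 h with ⟨h1, h2⟩ | ⟨h1, h2⟩
      · exact hy.ne h1
      · exact hxy h2
  obtain ⟨a, ha, b, hb, hab, hne⟩ := hG v _ hcyc (by simp; omega)
  have hedges : (SimpleGraph.Walk.cons hx (p.concat hy.symm)).edges
      = s(v, x) :: (p.edges ++ [s(y, v)]) := by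
    simp [SimpleGraph.Walk.edges_concat, List.concat_eq_append]
  have hsupp : ∀ c ∈ (SimpleGraph.Walk.cons hx (p.concat hy.symm)).support,
      c = v ∨ c ∈ p.support := by
    intro c hc
    simp only [SimpleGraph.Walk.support_cons, SimpleGraph.Walk.support_concat,
      List.mem_cons, List.mem_append, List.not_mem_nil, or_false] at hc
    tauto
  rw [hedges] at hne
  simp only [List.mem_cons, List.mem_append, List.not_mem_nil, or_false, not_or] at hne
  -- A chord at `v` would end at `x` or `y`, and so be an edge of the cycle.
  have hv : ∀ c ∈ p.support, G.Adj v c → c = x ∨ c = y := fun c hc hvc => by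
    rcases hp c hc with h | h | h
    · exact Or.inl h
    · exact Or.inr h
    · exact absurd hvc h.2
  have hinner : ∀ i j, i ≤ j → j ≤ p.length → G.Adj (p.getVert i) (p.getVert j) →
      s(p.getVert i, p.getVert j) ∉ p.edges → False := by
    intro i j hij hj hadj hnot
    rcases hij.eq_or_lt with rfl | hij
    · exact G.loopless.irrefl _ hadj
    rcases (Nat.succ_le_of_lt hij).eq_or_lt with rfl | hij'
    · refine hnot ?_
      exact p.mk_mem_edges_iff_exists.2 ⟨i, by omega, rfl⟩
    · refine hlt ⟨(p.take i).append (SimpleGraph.Walk.cons hadj (p.drop j)), ?_, ?_⟩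
      · simp only [SimpleGraph.Walk.length_append, SimpleGraph.Walk.length_cons,
          SimpleGraph.Walk.take_length, SimpleGraph.Walk.drop_length]
        omega
      · intro z hz
        rw [SimpleGraph.Walk.mem_support_append_iff, SimpleGraph.Walk.support_cons,
          List.mem_cons] at hz
        rcases hz with hz | rfl | hz
        · exact (p.isSubwalk_take i).support_subset hz
        · exact p.getVert_mem_support i
        · exact (p.isSubwalk_drop j).support_subset hz
  rcases hsupp a ha with rfl | hap <;> rcases hsupp b hb with rfl | hbp
  · exact G.loopless.irrefl _ hab
  · rcases hv b hbp hab with rfl | rfl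
    · exact hne.1 rfl
    · exact hne.2.2 Sym2.eq_swap
  · rcases hv a hap hab.symm with rfl | rfl
    · exact hne.1 Sym2.eq_swap
    · exact hne.2.2 rfl
  · obtain ⟨i, rfl, hi⟩ := SimpleGraph.Walk.mem_support_iff_exists_getVert.1 hap
    obtain ⟨j, rfl, hj⟩ := SimpleGraph.Walk.mem_support_iff_exists_getVert.1 hbp
    rcases le_total i j with h | h
    · exact hinner i j h hj hab hne.2.1
    · exact hinner j i h hi hab.symm (by rw [Sym2.eq_swap]; exact hne.2.1)

/-- In the subgraph of a chordal graph induced by `W`, a vertex `v` that is not adjacent to all the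
others has a non-neighbour `s` that is simplicial: its neighbours in `W` are pairwise adjacent.

The component `C` of a non-neighbour `w` in the complement of the closed neighbourhood of `v` is
attached to a set `S` of neighbours of `v`, which is a clique. In `C ∪ S`, which misses `v`, either
all vertices are adjacent and `w` is simplicial, or induction gives a simplicial vertex in `C`. -/
theorem IsTriangulated.exists_simplicial_not_adj [DecidableEq V] {G : SimpleGraph V}
    (hG : IsTriangulated G) (W : Finset V) {v w : V} (hv : v ∈ W) (hw : w ∈ W) (hvw : w ≠ v)
    (hadj : ¬ G.Adj v w) :
    ∃ s ∈ W, s ≠ v ∧ ¬ G.Adj v s ∧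
      ∀ x ∈ W, ∀ y ∈ W, G.Adj s x → G.Adj s y → x ≠ y → G.Adj x y := by
  classical
  induction W using Finset.strongInduction generalizing v w with
  | _ W ih =>
  let C : Finset V := W.filter fun c =>
    ∃ p : G.Walk w c, ∀ z ∈ p.support, z ∈ W ∧ z ≠ v ∧ ¬ G.Adj v z
  let S : Finset V := W.filter fun s => G.Adj v s ∧ ∃ c ∈ C, G.Adj c s
  have hCW : ∀ c ∈ C, c ∈ W ∧ c ≠ v ∧ ¬ G.Adj v c := fun c hc => by
    obtain ⟨-, p, hp⟩ := Finset.mem_filter.1 hc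
    exact hp c p.end_mem_support
  have hwC : w ∈ C := by
    refine Finset.mem_filter.2 ⟨hw, SimpleGraph.Walk.nil, fun z hz => ?_⟩
    rw [SimpleGraph.Walk.mem_support_nil_iff] at hz
    exact hz ▸ ⟨hw, hvw, hadj⟩
  have hnbr : ∀ c ∈ C, ∀ x ∈ W, G.Adj c x → x ∈ C ∪ S := by
    intro c hc x hx hcx
    rw [Finset.mem_union]
    by_cases hvx : G.Adj v x
    · exact Or.inr (Finset.mem_filter.2 ⟨hx, hvx, c, hc, hcx⟩)
    · obtain ⟨-, p, hp⟩ := Finset.mem_filter.1 hc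
      have hxv : x ≠ v := by
        rintro rfl
        exact (hCW c hc).2.2 hcx.symm
      refine Or.inl (Finset.mem_filter.2 ⟨hx, p.concat hcx, fun z hz => ?_⟩)
      rw [SimpleGraph.Walk.support_concat, List.mem_append, List.mem_singleton] at hz
      rcases hz with hz | rfl
      · exact hp z hz
      · exact ⟨hx, hxv, hvx⟩
  have hS : ∀ x ∈ S, ∀ y ∈ S, x ≠ y → G.Adj x y := by
    intro x hx y hy hxy
    obtain ⟨-, hvx, c, hc, hcx⟩ := Finset.mem_filter.1 hx
    obtain ⟨-, hvy, d, hd, hdy⟩ := Finset.mem_filter.1 hy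
    obtain ⟨-, p, hp⟩ := Finset.mem_filter.1 hc
    obtain ⟨-, q, hq⟩ := Finset.mem_filter.1 hd
    refine hG.adj_of_walk hvx hvy hxy
      (SimpleGraph.Walk.cons hcx.symm ((p.reverse.append q).concat hdy)) fun z hz => ?_
    simp only [SimpleGraph.Walk.support_cons, SimpleGraph.Walk.support_concat,
      List.mem_cons, List.mem_append, List.not_mem_nil, or_false,
      SimpleGraph.Walk.mem_support_append_iff, SimpleGraph.Walk.support_reverse,
      List.mem_reverse] at hz
    rcases hz with h | (h | h) | h
    · exact Or.inl h
    · exact Or.inr (Or.inr (hp z h).2)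
    · exact Or.inr (Or.inr (hq z h).2)
    · exact Or.inr (Or.inl h)
  have hlt : C ∪ S ⊂ W := by
    refine (Finset.ssubset_iff_of_subset ?_).2 ⟨v, hv, ?_⟩
    · exact Finset.union_subset (Finset.filter_subset _ _) (Finset.filter_subset _ _)
    · rw [Finset.mem_union]
      rintro (h | h)
      · exact (hCW v h).2.1 rfl
      · exact G.loopless.irrefl _ (Finset.mem_filter.1 h).2.1
  -- It suffices to find a vertex of `C` that is simplicial in `C ∪ S`.
  have hlift : ∀ s ∈ C, (∀ x ∈ C ∪ S, ∀ y ∈ C ∪ S, G.Adj s x → G.Adj s y → x ≠ y → G.Adj x y) →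
      ∃ s ∈ W, s ≠ v ∧ ¬ G.Adj v s ∧
        ∀ x ∈ W, ∀ y ∈ W, G.Adj s x → G.Adj s y → x ≠ y → G.Adj x y := by
    intro s hs h
    obtain ⟨h1, h2, h3⟩ := hCW s hs
    exact ⟨s, h1, h2, h3, fun x hx y hy hsx hsy =>
      h x (hnbr s hs x hx hsx) y (hnbr s hs y hy hsy) hsx hsy⟩
  by_cases h1 : ∃ s ∈ S, ∃ c ∈ C, c ≠ s ∧ ¬ G.Adj s c
  · obtain ⟨s, hs, c, hc, hcs, hsc⟩ := h1
    obtain ⟨t, ht, hts, hst, h⟩ := ih _ hlt (Finset.mem_union_right _ hs)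
      (Finset.mem_union_left _ hc) hcs hsc
    rcases Finset.mem_union.1 ht with htC | htS
    · exact hlift t htC h
    · exact absurd (hS s hs t htS hts.symm) hst
  push Not at h1
  have hne : ∀ s ∈ S, ∀ c ∈ C, c ≠ s := by
    rintro s hs c hc rfl
    exact (hCW c hc).2.2 (Finset.mem_filter.1 hs).2.1
  by_cases h2 : ∃ c ∈ C, ∃ d ∈ C, d ≠ c ∧ ¬ G.Adj c d
  · obtain ⟨c, hc, d, hd, hdc, hcd⟩ := h2
    obtain ⟨t, ht, htc, hct, h⟩ := ih _ hlt (Finset.mem_union_left _ hc)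
      (Finset.mem_union_left _ hd) hdc hcd
    rcases Finset.mem_union.1 ht with htC | htS
    · exact hlift t htC h
    · exact absurd (h1 t htS c hc (hne t htS c hc)).symm hct
  push Not at h2
  refine hlift w hwC fun x hx y hy _ _ hxy => ?_
  rcases Finset.mem_union.1 hx with hx | hx <;> rcases Finset.mem_union.1 hy with hy | hy
  · exact h2 x hx y hy hxy.symm
  · exact (h1 y hy x hx hxy).symm
  · exact h1 x hx y hy hxy.symm
  · exact hS x hx y hy hxy

/-- **Dirac's lemma**: every nonempty induced subgraph of a chordal graph has a simplicial vertex. -/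
theorem IsTriangulated.exists_simplicial [DecidableEq V] {G : SimpleGraph V}
    (hG : IsTriangulated G) {W : Finset V} (hW : W.Nonempty) :
    ∃ s ∈ W, ∀ x ∈ W, ∀ y ∈ W, G.Adj s x → G.Adj s y → x ≠ y → G.Adj x y := by
  by_cases h : ∃ v ∈ W, ∃ w ∈ W, w ≠ v ∧ ¬ G.Adj v w
  · obtain ⟨v, hv, w, hw, hvw, hadj⟩ := h
    obtain ⟨s, hs, -, -, h⟩ := hG.exists_simplicial_not_adj W hv hw hvw hadj
    exact ⟨s, hs, h⟩
  · push Not at h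
    obtain ⟨s, hs⟩ := hW
    exact ⟨s, hs, fun x hx y hy _ _ hxy => h x hx y hy hxy.symm⟩

/-! ### Triangulated Laman graphs are 2-trees -/

/-- The subgraph of `G` induced by the vertex set is a 2-tree: it is built up from an edge by
repeatedly adding a vertex `v` joined to exactly the two ends of an edge. -/
inductive IsTwoTree [DecidableEq V] (G : SimpleGraph V) : Finset V → Prop
  | edge {x y : V} (h : G.Adj x y) : IsTwoTree G {x, y}
  | addVertex {W : Finset V} {v x y : V} (hW : IsTwoTree G W) (hv : v ∉ W) (hx : x ∈ W) (hy : y ∈ W)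
      (hxy : G.Adj x y) (hvx : G.Adj v x) (hvy : G.Adj v y)
      (h : ∀ z ∈ W, G.Adj v z → z = x ∨ z = y) : IsTwoTree G (insert v W)

/-- Removing a vertex of a graph lowers the sum of the degrees by twice its degree. -/
theorem sum_card_adj_erase [DecidableEq V] {G : SimpleGraph V} [DecidableRel G.Adj] {W : Finset V}
    {v : V} (hv : v ∈ W) :
    ∑ x ∈ W, (W.filter (G.Adj x)).card =
      ∑ x ∈ W.erase v, ((W.erase v).filter (G.Adj x)).card
        + 2 * ((W.erase v).filter (G.Adj v)).card := by
  have h1 : ∀ x, (W.filter (G.Adj x)).card =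
      ((W.erase v).filter (G.Adj x)).card + if G.Adj x v then 1 else 0 := fun x => by
    rw [← Finset.insert_erase hv, Finset.filter_insert]
    split_ifs with h
    · rw [Finset.card_insert_of_notMem (by simp), Finset.insert_erase hv]
    · rw [Finset.insert_erase hv, add_zero]
  rw [← Finset.add_sum_erase _ _ hv, h1 v, if_neg (G.loopless.irrefl v)]
  simp only [h1, Finset.sum_add_distrib, ← Finset.card_filter, G.adj_comm _ v]
  ring

theorem card_filter_adj_le_two [DecidableEq V] {G : SimpleGraph V} [DecidableRel G.Adj]
    (hK : G.CliqueFree 4) {W : Finset V} {v : V}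
    (hs : ∀ x ∈ W, ∀ y ∈ W, G.Adj v x → G.Adj v y → x ≠ y → G.Adj x y) :
    (W.filter (G.Adj v)).card ≤ 2 := by
  by_contra! h
  obtain ⟨t, ht, ht3⟩ := Finset.exists_subset_card_eq h
  have hmem : ∀ x ∈ t, x ∈ W ∧ G.Adj v x := fun x hx => Finset.mem_filter.1 (ht hx)
  have h3 : G.IsNClique 3 t := ⟨fun x hx y hy hxy => hs x (hmem x hx).1 y (hmem y hy).1
    (hmem x hx).2 (hmem y hy).2 hxy, ht3⟩
  exact hK _ (h3.insert fun x hx => (hmem x hx).2)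

/-- A chordal graph without `K₄` on `n ≥ 2` vertices has at most `2 * n - 3` edges; these are counted
by the sum of the degrees in the subgraph induced by `W`, which is twice their number. -/
theorem IsTriangulated.sum_card_adj_le [DecidableEq V] {G : SimpleGraph V} [DecidableRel G.Adj]
    (hG : IsTriangulated G) (hK : G.CliqueFree 4) (W : Finset V) (hW : 2 ≤ W.card) :
    ∑ x ∈ W, (W.filter (G.Adj x)).card + 6 ≤ 4 * W.card := by
  induction W using Finset.strongInduction with
  | _ W ih =>
  obtain ⟨v, hv, hs⟩ := hG.exists_simplicial (W := W) (Finset.card_pos.1 (by omega))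
  have hcard := Finset.card_erase_of_mem hv
  rw [sum_card_adj_erase hv]
  by_cases h2 : W.card = 2
  · have h1 : ((W.erase v).filter (G.Adj v)).card ≤ (W.erase v).card :=
      Finset.card_filter_le _ _
    obtain ⟨x, hx⟩ := Finset.card_eq_one.1 (show (W.erase v).card = 1 by omega)
    have h0 : ∑ x ∈ W.erase v, ((W.erase v).filter (G.Adj x)).card = 0 := by
      simp [hx]
    omega
  · have h1 := ih _ (Finset.erase_ssubset hv) (by omega)
    have h3 := card_filter_adj_le_two hK (W := W.erase v) (v := v) fun x hx y hy =>
      hs x (Finset.mem_of_mem_erase hx) y (Finset.mem_of_mem_erase hy)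
    omega

/-- A chordal graph without `K₄` on `n ≥ 2` vertices with at least `2 * n - 3` edges is a 2-tree:
in view of `sum_card_adj_le`, a simplicial vertex must have degree exactly two. -/
theorem IsTriangulated.isTwoTree_of_le [DecidableEq V] {G : SimpleGraph V} [DecidableRel G.Adj]
    (hG : IsTriangulated G) (hK : G.CliqueFree 4) (W : Finset V) (hW : 2 ≤ W.card)
    (hE : 4 * W.card ≤ ∑ x ∈ W, (W.filter (G.Adj x)).card + 6) : IsTwoTree G W := by
  induction W using Finset.strongInduction with
  | _ W ih =>
  obtain ⟨v, hv, hs⟩ := hG.exists_simplicial (W := W) (Finset.card_pos.1 (by omega))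
  have hcard := Finset.card_erase_of_mem hv
  rw [sum_card_adj_erase hv] at hE
  have hle := card_filter_adj_le_two hK (W := W.erase v) (v := v) fun x hx y hy =>
    hs x (Finset.mem_of_mem_erase hx) y (Finset.mem_of_mem_erase hy)
  by_cases h2 : W.card = 2
  · obtain ⟨x, hx⟩ := Finset.card_eq_one.1 (show (W.erase v).card = 1 by omega)
    have hvx : G.Adj v x := by
      by_contra h
      rw [hx] at hE
      simp [Finset.filter_singleton, h] at hE
      omega
    rw [← Finset.insert_erase hv, hx]
    exact IsTwoTree.edge hvx
  · have h1 := hG.sum_card_adj_le hK (W.erase v) (by omega)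
    have htree := ih _ (Finset.erase_ssubset hv) (by omega) (by omega)
    obtain ⟨x, y, hxy, hN⟩ :=
      Finset.card_eq_two.1 (show ((W.erase v).filter (G.Adj v)).card = 2 by omega)
    have hx : x ∈ (W.erase v).filter (G.Adj v) := by simp [hN]
    have hy : y ∈ (W.erase v).filter (G.Adj v) := by simp [hN]
    rw [Finset.mem_filter] at hx hy
    rw [← Finset.insert_erase hv]
    refine htree.addVertex (Finset.notMem_erase v W) hx.1 hy.1 ?_ hx.2 hy.2 fun z hz hvz => ?_
    · exact hs x (Finset.mem_of_mem_erase hx.1) y (Finset.mem_of_mem_erase hy.1) hx.2 hy.2 hxy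
    · have hz' : z ∈ (W.erase v).filter (G.Adj v) := Finset.mem_filter.2 ⟨hz, hvz⟩
      simpa [hN] using hz'

theorem IsTriangulatedLaman.isTwoTree [Fintype V] [DecidableEq V] {G : SimpleGraph V}
    (hG : IsTriangulatedLaman G) (hn : 2 ≤ Fintype.card V) : IsTwoTree G Finset.univ := by
  classical
  refine hG.triangulated.isTwoTree_of_le hG.minimallyRigid.cliqueFree_four _ hn ?_
  have h1 := hG.minimallyRigid.1.two_mul_card_le
  have h2 := G.sum_degrees_eq_twice_card_edges
  have h3 : ∀ x, (Finset.univ.filter (G.Adj x)).card = G.degree x := fun x => by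
    rw [← G.card_neighborFinset_eq_degree, G.neighborFinset_eq_filter]
  simp only [h3, h2, Finset.card_univ]
  omega

/-- The triangle created by adding a vertex adjacent to both ends of an edge. -/
def Triangle.ofAdj [DecidableEq V] {G : SimpleGraph V} {v x y : V} (hvx : G.Adj v x)
    (hvy : G.Adj v y) (hxy : G.Adj x y) : Triangle G :=
  ⟨{v, x, y}, SimpleGraph.is3Clique_triple_iff.2 ⟨hvx, hvy, hxy⟩⟩

/-- A new vertex, joined to exactly the two ends of an edge, creates exactly one triangle. -/
theorem Triangle.subset_insert_iff [DecidableEq V] {G : SimpleGraph V} {W : Finset V} {v x y : V}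
    (hx : x ∈ W) (hy : y ∈ W) (hxy : G.Adj x y) (hvx : G.Adj v x)
    (hvy : G.Adj v y) (h : ∀ z ∈ W, G.Adj v z → z = x ∨ z = y) (Δ : Triangle G) :
    Δ.1 ⊆ insert v W ↔ Δ.1 ⊆ W ∨ Δ = Triangle.ofAdj hvx hvy hxy := by
  constructor
  · intro hΔ
    by_cases hvΔ : v ∈ Δ.1
    · right
      refine Subtype.ext (Finset.eq_of_subset_of_card_le (fun z hz => ?_) ?_)
      · rcases eq_or_ne z v with rfl | hzv
        · simp [Triangle.ofAdj]
        · have hzW := Finset.mem_of_mem_insert_of_ne (hΔ hz) hzv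
          have := h z hzW (Δ.2.isClique hvΔ hz hzv.symm)
          simp only [Triangle.ofAdj, Finset.mem_insert, Finset.mem_singleton]
          exact Or.inr this
      · rw [Δ.2.card_eq, (Triangle.ofAdj hvx hvy hxy).2.card_eq]
    · exact Or.inl fun z hz => Finset.mem_of_mem_insert_of_ne (hΔ hz) (fun h => hvΔ (h ▸ hz))
  · rintro (hΔ | rfl)
    · exact hΔ.trans (Finset.subset_insert v W)
    · simp [Triangle.ofAdj, Finset.insert_subset_iff, hx, hy]

theorem IsTwoTree.card_triangle [Fintype V] [DecidableEq V] {G : SimpleGraph V} {W : Finset V}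
    (hW : IsTwoTree G W) : Nat.card {Δ : Triangle G // Δ.1 ⊆ W} + 2 = W.card := by
  classical
  induction hW with
  | @edge x y h =>
    have : IsEmpty {Δ : Triangle G // Δ.1 ⊆ {x, y}} := ⟨fun Δ => by
      have := Finset.card_le_card Δ.2
      rw [Δ.1.2.card_eq, Finset.card_pair h.ne] at this
      omega⟩
    rw [Nat.card_of_isEmpty, Finset.card_pair h.ne]
  | @addVertex W v x y hW hv hx hy hxy hvx hvy h ih =>
    have hset : {Δ : Triangle G | Δ.1 ⊆ insert v W} =
        insert (Triangle.ofAdj hvx hvy hxy) {Δ : Triangle G | Δ.1 ⊆ W} := by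
      ext Δ
      simp only [Set.mem_ofPred_eq, Set.mem_insert_iff,
        Triangle.subset_insert_iff hx hy hxy hvx hvy h Δ, or_comm]
    have hnot : Triangle.ofAdj hvx hvy hxy ∉ {Δ : Triangle G | Δ.1 ⊆ W} := fun hΔ =>
      hv (hΔ (by simp [Triangle.ofAdj]))
    have h1 := Set.ncard_insert_of_notMem hnot (Set.toFinite _)
    rw [← hset] at h1
    rw [Finset.card_insert_of_notMem hv, ← ih]
    change Set.ncard {Δ : Triangle G | Δ.1 ⊆ insert v W} + 2
      = Set.ncard {Δ : Triangle G | Δ.1 ⊆ W} + 2 + 1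
    omega

theorem IsTwoTree.exists_triangle_mem [DecidableEq V] {G : SimpleGraph V} {W : Finset V}
    (hW : IsTwoTree G W) (h3 : 3 ≤ W.card) : ∀ v ∈ W, ∃ Δ : Triangle G, v ∈ Δ.1 := by
  induction hW with
  | edge h => rw [Finset.card_pair h.ne] at h3; omega
  | @addVertex W v x y hW hv hx hy hxy hvx hvy h ih =>
    intro z hz
    by_cases hz' : z ∈ (Triangle.ofAdj hvx hvy hxy).1
    · exact ⟨_, hz'⟩
    simp only [Triangle.ofAdj, Finset.mem_insert, Finset.mem_singleton, not_or] at hz'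
    have hzW := Finset.mem_of_mem_insert_of_ne hz hz'.1
    refine ih ?_ z hzW
    calc 3 = ({z, x, y} : Finset V).card := by
          rw [Finset.card_eq_three.2 ⟨z, x, y, hz'.2.1, hz'.2.2, hxy.ne, rfl⟩]
      _ ≤ W.card := Finset.card_le_card (by simp [Finset.insert_subset_iff, hzW, hx, hy])

/-! ### The invariant measures of the triangles -/

/-- A family of nonnegative weights `w Δ` on the vertex set `W`, for the triangles `Δ` inside `W`,
such that `w Δ` is proportional to the local weights `a Δ` on `Δ`, with ratio the mass `M Δ > 0`,
and such that for two triangles with a common edge `xy` the weights agree outside `xy` and have the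
same total on `xy`. -/
structure IsBalanced {G : SimpleGraph V} (a : Triangle G → V → ℝ) (W : Finset V)
    (M : Triangle G → ℝ) (w : Triangle G → V → ℝ) : Prop where
  mass_pos : ∀ Δ : Triangle G, Δ.1 ⊆ W → 0 < M Δ
  nonneg : ∀ Δ : Triangle G, Δ.1 ⊆ W → ∀ v ∈ W, 0 ≤ w Δ v
  eq_mass_mul : ∀ Δ : Triangle G, Δ.1 ⊆ W → ∀ v ∈ Δ.1, w Δ v = M Δ * a Δ v
  eq_off_edge : ∀ Δ Δ' : Triangle G, Δ.1 ⊆ W → Δ'.1 ⊆ W → ∀ x y, x ≠ y → x ∈ Δ.1 → y ∈ Δ.1 →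
    x ∈ Δ'.1 → y ∈ Δ'.1 → ∀ v ∈ W, v ≠ x → v ≠ y → w Δ v = w Δ' v
  edge_sum : ∀ Δ Δ' : Triangle G, Δ.1 ⊆ W → Δ'.1 ⊆ W → ∀ x y, x ≠ y → x ∈ Δ.1 → y ∈ Δ.1 →
    x ∈ Δ'.1 → y ∈ Δ'.1 → w Δ x + w Δ y = w Δ' x + w Δ' y

/-- On a 2-tree, balanced weights exist. A triangle `Δ'` created on the edge `xy` by a new vertex
`v` receives the mass that makes its total on `xy` the one common to all the older triangles at
`xy`; the weights of `Δ'` outside `Δ'` are copied from such a triangle, and all the older triangles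
receive at `v` the weight that `Δ'` has there. -/
theorem IsTwoTree.exists_isBalanced [DecidableEq V] {G : SimpleGraph V} {W : Finset V}
    (hW : IsTwoTree G W) {a : Triangle G → V → ℝ} (ha : IsLocalWeight a)
    (hpos : IsPositiveOnNonsimpleEdges a) : ∃ M w, IsBalanced a W M w := by
  induction hW with
  | @edge x y h =>
    have hnot : ∀ Δ : Triangle G, ¬ Δ.1 ⊆ {x, y} := fun Δ hΔ => by
      have := Finset.card_le_card hΔ
      rw [Δ.2.card_eq, Finset.card_pair h.ne] at this
      omega
    exact ⟨0, 0, fun Δ h => (hnot Δ h).elim, fun Δ h => (hnot Δ h).elim,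
      fun Δ h => (hnot Δ h).elim, fun Δ _ h => (hnot Δ h).elim, fun Δ _ h => (hnot Δ h).elim⟩
  | @addVertex W v x y hW hv hx hy hxy hvx hvy h ih =>
    obtain ⟨M, w, hb⟩ := ih
    set Δ' : Triangle G := Triangle.ofAdj hvx hvy hxy with hΔ'
    have hmem : ∀ z, z ∈ Δ'.1 ↔ z = v ∨ z = x ∨ z = y := by simp [Δ', Triangle.ofAdj]
    have hsub := Triangle.subset_insert_iff hx hy hxy hvx hvy h
    have hold : ∀ Δ : Triangle G, Δ.1 ⊆ W → Δ ≠ Δ' := by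
      rintro Δ hΔ rfl
      exact hv (hΔ ((hmem v).2 (Or.inl rfl)))
    have hvW : ∀ z ∈ W, z ≠ v := fun z hz hzv => hv (hzv ▸ hz)
    -- The mass of the new triangle and its weights outside of it.
    obtain ⟨m, g, hm, hg, hgw, hgs⟩ : ∃ (m : ℝ) (g : V → ℝ), 0 < m ∧ (∀ z ∈ W, 0 ≤ g z) ∧
        (∀ Δ : Triangle G, Δ.1 ⊆ W → x ∈ Δ.1 → y ∈ Δ.1 →
          ∀ z ∈ W, z ≠ x → z ≠ y → w Δ z = g z) ∧
        (∀ Δ : Triangle G, Δ.1 ⊆ W → x ∈ Δ.1 → y ∈ Δ.1 →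
          w Δ x + w Δ y = m * a Δ' x + m * a Δ' y) := by
      by_cases hex : ∃ Δ : Triangle G, Δ.1 ⊆ W ∧ x ∈ Δ.1 ∧ y ∈ Δ.1
      · obtain ⟨Δ, hΔ, hxΔ, hyΔ⟩ := hex
        have h1 : 0 < a Δ x + a Δ y := hpos Δ x hxΔ y hyΔ hxy.ne
          ⟨Δ', (hold Δ hΔ).symm, by simp [hmem], by simp [hmem]⟩
        have h2 : 0 < a Δ' x + a Δ' y := hpos Δ' x (by simp [hmem]) y (by simp [hmem]) hxy.ne
          ⟨Δ, hold Δ hΔ, hxΔ, hyΔ⟩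
        refine ⟨M Δ * (a Δ x + a Δ y) / (a Δ' x + a Δ' y), w Δ,
          div_pos (mul_pos (hb.mass_pos Δ hΔ) h1) h2, hb.nonneg Δ hΔ,
          fun Δ₁ hΔ₁ hx₁ hy₁ => hb.eq_off_edge Δ₁ Δ hΔ₁ hΔ x y hxy.ne hx₁ hy₁ hxΔ hyΔ,
          fun Δ₁ hΔ₁ hx₁ hy₁ => ?_⟩
        rw [hb.edge_sum Δ₁ Δ hΔ₁ hΔ x y hxy.ne hx₁ hy₁ hxΔ hyΔ, hb.eq_mass_mul Δ hΔ x hxΔ,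
          hb.eq_mass_mul Δ hΔ y hyΔ, ← mul_add, ← mul_add, div_mul_cancel₀ _ h2.ne']
      · exact ⟨1, 0, one_pos, fun _ _ => le_rfl,
          fun Δ hΔ hx hy => (hex ⟨Δ, hΔ, hx, hy⟩).elim,
          fun Δ hΔ hx hy => (hex ⟨Δ, hΔ, hx, hy⟩).elim⟩
    let M₁ : Triangle G → ℝ := fun Δ => if Δ = Δ' then m else M Δ
    let w₁ : Triangle G → V → ℝ := fun Δ z =>
      if Δ = Δ' then (if z ∈ Δ'.1 then m * a Δ' z else g z)
      else if z = v then m * a Δ' v else w Δ z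
    have hM' : M₁ Δ' = m := if_pos rfl
    have hM : ∀ Δ : Triangle G, Δ.1 ⊆ W → M₁ Δ = M Δ := fun Δ hΔ => if_neg (hold Δ hΔ)
    have hw1 : ∀ z ∈ Δ'.1, w₁ Δ' z = m * a Δ' z := fun z hz => by simp only [w₁, if_true, if_pos hz]
    have hw2 : ∀ z, z ∉ Δ'.1 → w₁ Δ' z = g z := fun z hz => by simp only [w₁, if_true, if_neg hz]
    have hw3 : ∀ Δ : Triangle G, Δ.1 ⊆ W → w₁ Δ v = m * a Δ' v := fun Δ hΔ => by
      simp only [w₁, if_neg (hold Δ hΔ), if_true]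
    have hw4 : ∀ Δ : Triangle G, Δ.1 ⊆ W → ∀ z ∈ W, w₁ Δ z = w Δ z := fun Δ hΔ z hz => by
      simp only [w₁, if_neg (hold Δ hΔ), if_neg (hvW z hz)]
    have ha' : ∀ z ∈ Δ'.1, 0 ≤ m * a Δ' z := fun z hz => mul_nonneg hm.le ((ha Δ').1 z hz)
    have hvΔ' : v ∈ Δ'.1 := (hmem v).2 (Or.inl rfl)
    have hxΔ' : x ∈ Δ'.1 := (hmem x).2 (Or.inr (Or.inl rfl))
    have hyΔ' : y ∈ Δ'.1 := (hmem y).2 (Or.inr (Or.inr rfl))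
    -- An older triangle can share only the edge `xy` with the new one.
    have hshare : ∀ Δ : Triangle G, Δ.1 ⊆ W → ∀ p q, p ≠ q → p ∈ Δ.1 → q ∈ Δ.1 → p ∈ Δ'.1 →
        q ∈ Δ'.1 → (p = x ∧ q = y) ∨ (p = y ∧ q = x) := by
      intro Δ hΔ p q hpq hp hq hp' hq'
      have h1 := ((hmem p).1 hp').resolve_left (hvW p (hΔ hp))
      have h2 := ((hmem q).1 hq').resolve_left (hvW q (hΔ hq))
      rcases h1 with rfl | rfl <;> rcases h2 with rfl | rfl <;> simp_all
    have hoff : ∀ Δ : Triangle G, Δ.1 ⊆ W → x ∈ Δ.1 → y ∈ Δ.1 → ∀ z ∈ insert v W, z ≠ x → z ≠ y →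
        w₁ Δ z = w₁ Δ' z := by
      intro Δ hΔ hxΔ hyΔ z hz hzx hzy
      rcases Finset.mem_insert.1 hz with rfl | hzW
      · rw [hw3 Δ hΔ, hw1 _ hvΔ']
      · rw [hw4 Δ hΔ z hzW, hw2 z (by simp [hmem, hvW z hzW, hzx, hzy]),
          hgw Δ hΔ hxΔ hyΔ z hzW hzx hzy]
    have hsum : ∀ Δ : Triangle G, Δ.1 ⊆ W → x ∈ Δ.1 → y ∈ Δ.1 →
        w₁ Δ x + w₁ Δ y = w₁ Δ' x + w₁ Δ' y := by
      intro Δ hΔ hxΔ hyΔ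
      rw [hw4 Δ hΔ x hx, hw4 Δ hΔ y hy, hw1 x hxΔ', hw1 y hyΔ', hgs Δ hΔ hxΔ hyΔ]
    refine ⟨M₁, w₁, ⟨?_, ?_, ?_, ?_, ?_⟩⟩
    · intro Δ hΔ
      rcases (hsub Δ).1 hΔ with hΔW | rfl
      · rw [hM Δ hΔW]
        exact hb.mass_pos Δ hΔW
      · rwa [hM']
    · intro Δ hΔ z hz
      rcases (hsub Δ).1 hΔ with hΔW | rfl
      · rcases Finset.mem_insert.1 hz with rfl | hzW
        · rw [hw3 Δ hΔW]
          exact ha' _ hvΔ'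
        · rw [hw4 Δ hΔW z hzW]
          exact hb.nonneg Δ hΔW z hzW
      · by_cases hzΔ : z ∈ Δ'.1
        · rw [hw1 z hzΔ]
          exact ha' z hzΔ
        · rw [hw2 z hzΔ]
          exact hg z (Finset.mem_of_mem_insert_of_ne hz fun hzv => hzΔ (hzv ▸ hvΔ'))
    · intro Δ hΔ z hz
      rcases (hsub Δ).1 hΔ with hΔW | rfl
      · rw [hw4 Δ hΔW z (hΔW hz), hM Δ hΔW, hb.eq_mass_mul Δ hΔW z hz]
      · rw [hw1 z hz, hM']
    · intro Δ₁ Δ₂ h₁ h₂ p q hpq hp₁ hq₁ hp₂ hq₂ z hz hzp hzq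
      rcases (hsub Δ₁).1 h₁ with k₁ | rfl <;> rcases (hsub Δ₂).1 h₂ with k₂ | rfl
      · rcases Finset.mem_insert.1 hz with rfl | hzW
        · rw [hw3 Δ₁ k₁, hw3 Δ₂ k₂]
        · rw [hw4 Δ₁ k₁ z hzW, hw4 Δ₂ k₂ z hzW]
          exact hb.eq_off_edge Δ₁ Δ₂ k₁ k₂ p q hpq hp₁ hq₁ hp₂ hq₂ z hzW hzp hzq
      · rcases hshare Δ₁ k₁ p q hpq hp₁ hq₁ hp₂ hq₂ with ⟨rfl, rfl⟩ | ⟨rfl, rfl⟩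
        · exact hoff Δ₁ k₁ hp₁ hq₁ z hz hzp hzq
        · exact hoff Δ₁ k₁ hq₁ hp₁ z hz hzq hzp
      · rcases hshare Δ₂ k₂ p q hpq hp₂ hq₂ hp₁ hq₁ with ⟨rfl, rfl⟩ | ⟨rfl, rfl⟩
        · exact (hoff Δ₂ k₂ hp₂ hq₂ z hz hzp hzq).symm
        · exact (hoff Δ₂ k₂ hq₂ hp₂ z hz hzq hzp).symm
      · rfl
    · intro Δ₁ Δ₂ h₁ h₂ p q hpq hp₁ hq₁ hp₂ hq₂
      rcases (hsub Δ₁).1 h₁ with k₁ | rfl <;> rcases (hsub Δ₂).1 h₂ with k₂ | rfl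
      · rw [hw4 Δ₁ k₁ p (k₁ hp₁), hw4 Δ₁ k₁ q (k₁ hq₁), hw4 Δ₂ k₂ p (k₂ hp₂),
          hw4 Δ₂ k₂ q (k₂ hq₂)]
        exact hb.edge_sum Δ₁ Δ₂ k₁ k₂ p q hpq hp₁ hq₁ hp₂ hq₂
      · rcases hshare Δ₁ k₁ p q hpq hp₁ hq₁ hp₂ hq₂ with ⟨rfl, rfl⟩ | ⟨rfl, rfl⟩
        · exact hsum Δ₁ k₁ hp₁ hq₁
        · rw [add_comm, hsum Δ₁ k₁ hq₁ hp₁, add_comm]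
      · rcases hshare Δ₂ k₂ p q hpq hp₂ hq₂ hp₁ hq₁ with ⟨rfl, rfl⟩ | ⟨rfl, rfl⟩
        · exact (hsum Δ₂ k₂ hp₂ hq₂).symm
        · rw [add_comm, ← hsum Δ₂ k₂ hq₂ hp₂, add_comm]
      · rfl

/-! ### One averaging step: the conserved mean and the decreasing energy -/

section Step

variable {G : SimpleGraph V} {a : Triangle G → V → ℝ} {M : Triangle G → ℝ} {w : Triangle G → V → ℝ}

theorem IsLocalWeight.mem_Icc (ha : IsLocalWeight a) (Δ : Triangle G) {f : V → ℝ} {l u : ℝ}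
    (hf : ∀ v ∈ Δ.1, l ≤ f v ∧ f v ≤ u) :
    l ≤ ∑ v ∈ Δ.1, a Δ v * f v ∧ ∑ v ∈ Δ.1, a Δ v * f v ≤ u := by
  have h : ∀ c : ℝ, ∑ v ∈ Δ.1, a Δ v * c = c := fun c => by
    rw [← Finset.sum_mul, (ha Δ).2, one_mul]
  constructor
  · conv_lhs => rw [← h l]
    exact Finset.sum_le_sum fun v hv => mul_le_mul_of_nonneg_left (hf v hv).1 ((ha Δ).1 v hv)
  · conv_rhs => rw [← h u]
    exact Finset.sum_le_sum fun v hv => mul_le_mul_of_nonneg_left (hf v hv).2 ((ha Δ).1 v hv)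

/-- If `f` takes the value `r` at two vertices `p`, `q` of a triangle, then the difference between
`r` and the local mean of `f` is controlled by the local variance of `f`. -/
theorem IsLocalWeight.mul_sq_le_variance (ha : IsLocalWeight a) {Δ : Triangle G} {p q : V}
    (hp : p ∈ Δ.1) (hq : q ∈ Δ.1) (hpq : p ≠ q) {f : V → ℝ} {r : ℝ} (hfp : f p = r)
    (hfq : f q = r) :
    (a Δ p + a Δ q) * (∑ v ∈ Δ.1, a Δ v * f v - r) ^ 2 ≤
      ∑ v ∈ Δ.1, a Δ v * f v ^ 2 - (∑ v ∈ Δ.1, a Δ v * f v) ^ 2 := by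
  classical
  have hq' : q ∈ Δ.1.erase p := Finset.mem_erase.2 ⟨hpq.symm, hq⟩
  obtain ⟨z, hz⟩ := Finset.card_eq_one.1 (show ((Δ.1.erase p).erase q).card = 1 by
    rw [Finset.card_erase_of_mem hq', Finset.card_erase_of_mem hp, Δ.2.card_eq])
  have hsum : ∀ g : V → ℝ, ∑ v ∈ Δ.1, g v = g p + (g q + g z) := fun g => by
    rw [← Finset.add_sum_erase _ _ hp, ← Finset.add_sum_erase _ _ hq', hz, Finset.sum_singleton]
  have hzΔ : z ∈ Δ.1 := by
    have : z ∈ (Δ.1.erase p).erase q := by simp [hz]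
    exact Finset.mem_of_mem_erase (Finset.mem_of_mem_erase this)
  have h1 := (ha Δ).2
  rw [hsum] at h1
  simp only [hsum, hfp, hfq]
  have hz0 := (ha Δ).1 z hzΔ
  have hb := add_nonneg ((ha Δ).1 p hp) ((ha Δ).1 q hq)
  obtain ⟨b, hbdef⟩ : ∃ b, b = a Δ p + a Δ q := ⟨_, rfl⟩
  have hq0 : a Δ q = b - a Δ p := by linarith
  have hz1 : a Δ z = 1 - b := by linarith
  rw [hz1] at hz0
  rw [← hbdef] at hb
  -- Both sides are multiples of `(f z - r) ^ 2`, by `b * (1 - b) ^ 2` and `b * (1 - b)`.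
  have h2 : 0 ≤ b ^ 2 * (1 - b) * (f z - r) ^ 2 := by positivity
  rw [hz1, hq0]
  nlinarith [h2]

variable [Fintype V]

/-- The measures of two triangles with a common edge give the same integral to a function that is
constant on that edge. -/
theorem IsBalanced.sum_mul_eq_of_edge (hb : IsBalanced a Finset.univ M w) {Δ Δ' : Triangle G}
    {p q : V} (hpq : p ≠ q) (hp : p ∈ Δ.1) (hq : q ∈ Δ.1) (hp' : p ∈ Δ'.1) (hq' : q ∈ Δ'.1)
    {f : V → ℝ} (hf : f p = f q) : ∑ v, w Δ v * f v = ∑ v, w Δ' v * f v := by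
  rw [← sub_eq_zero, ← Finset.sum_sub_distrib,
    Finset.sum_eq_add p q hpq (fun v _ hv => ?_) (by simp) (by simp)]
  · have := hb.edge_sum Δ Δ' (Finset.subset_univ _) (Finset.subset_univ _) p q hpq hp hq hp' hq'
    rw [hf]
    linear_combination f q * this
  · rw [hb.eq_off_edge Δ Δ' (Finset.subset_univ _) (Finset.subset_univ _) p q hpq hp hq hp' hq' v
      (Finset.mem_univ v) hv.1 hv.2, sub_self]

variable [DecidableEq V]

theorem localMatrix_mulVec_of_mem {Δ : Triangle G} {v : V} (hv : v ∈ Δ.1) (f : V → ℝ) :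
    (localMatrix a Δ).mulVec f v = ∑ u ∈ Δ.1, a Δ u * f u := by
  simp [localMatrix, Matrix.mulVec, dotProduct, hv, Finset.sum_ite_mem]

theorem localMatrix_mulVec_of_notMem {Δ : Triangle G} {v : V} (hv : v ∉ Δ.1) (f : V → ℝ) :
    (localMatrix a Δ).mulVec f v = f v := by
  simp [localMatrix, Matrix.mulVec, dotProduct, hv]

theorem IsLocalWeight.mulVec_mem_Icc (ha : IsLocalWeight a) (Δ : Triangle G) {f : V → ℝ} {l u : ℝ}
    (hf : ∀ v, l ≤ f v ∧ f v ≤ u) (v : V) :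
    l ≤ (localMatrix a Δ).mulVec f v ∧ (localMatrix a Δ).mulVec f v ≤ u := by
  by_cases hv : v ∈ Δ.1
  · rw [localMatrix_mulVec_of_mem hv]
    exact ha.mem_Icc Δ fun v _ => hf v
  · rw [localMatrix_mulVec_of_notMem hv]
    exact hf v

theorem IsBalanced.sum_mul_eq (hb : IsBalanced a Finset.univ M w) (Δ : Triangle G) (f : V → ℝ) :
    ∑ v, w Δ v * f v = M Δ * ∑ v ∈ Δ.1, a Δ v * f v + ∑ v ∈ Δ.1ᶜ, w Δ v * f v := by
  rw [← Finset.sum_add_sum_compl Δ.1, Finset.mul_sum]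
  congr 1
  refine Finset.sum_congr rfl fun v hv => ?_
  rw [hb.eq_mass_mul Δ (Finset.subset_univ _) v hv, mul_assoc]

/-- The measure `w Δ` is invariant under the averaging over `Δ`. -/
theorem IsBalanced.sum_mul_mulVec (hb : IsBalanced a Finset.univ M w) (ha : IsLocalWeight a)
    (Δ : Triangle G) (f : V → ℝ) :
    ∑ v, w Δ v * (localMatrix a Δ).mulVec f v = ∑ v, w Δ v * f v := by
  rw [hb.sum_mul_eq Δ, hb.sum_mul_eq Δ]
  refine congrArg₂ (· + ·) (congrArg (M Δ * ·) ?_) ?_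
  · rw [Finset.sum_congr rfl fun v hv =>
      congrArg (a Δ v * ·) (localMatrix_mulVec_of_mem hv f), ← Finset.sum_mul,
      (ha Δ).2, one_mul]
  · refine Finset.sum_congr rfl fun v hv => ?_
    rw [localMatrix_mulVec_of_notMem (Finset.mem_compl.1 hv)]

/-- Averaging over `Δ` lowers the second moment under `w Δ` by the local variance. -/
theorem IsBalanced.sum_mul_mulVec_sq (hb : IsBalanced a Finset.univ M w) (ha : IsLocalWeight a)
    (Δ : Triangle G) (f : V → ℝ) :
    ∑ v, w Δ v * f v ^ 2 - ∑ v, w Δ v * (localMatrix a Δ).mulVec f v ^ 2 =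
      M Δ * (∑ v ∈ Δ.1, a Δ v * f v ^ 2 - (∑ v ∈ Δ.1, a Δ v * f v) ^ 2) := by
  rw [hb.sum_mul_eq Δ fun v => f v ^ 2, hb.sum_mul_eq Δ fun v => (localMatrix a Δ).mulVec f v ^ 2]
  have h1 : ∑ v ∈ Δ.1, a Δ v * (localMatrix a Δ).mulVec f v ^ 2
      = (∑ v ∈ Δ.1, a Δ v * f v) ^ 2 := by
    rw [Finset.sum_congr rfl fun v hv =>
      congrArg (fun y => a Δ v * y ^ 2) (localMatrix_mulVec_of_mem hv f), ← Finset.sum_mul,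
      (ha Δ).2, one_mul]
  have h2 : ∑ v ∈ Δ.1ᶜ, w Δ v * (localMatrix a Δ).mulVec f v ^ 2
      = ∑ v ∈ Δ.1ᶜ, w Δ v * f v ^ 2 := by
    refine Finset.sum_congr rfl fun v hv => ?_
    rw [localMatrix_mulVec_of_notMem (Finset.mem_compl.1 hv)]
  rw [h1, h2]
  ring

theorem IsBalanced.sum_pos (hb : IsBalanced a Finset.univ M w) (ha : IsLocalWeight a)
    (Δ : Triangle G) : 0 < ∑ v, w Δ v := by
  have h := hb.sum_mul_eq Δ 1
  simp only [Pi.one_apply, mul_one, (ha Δ).2] at h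
  rw [h]
  exact add_pos_of_pos_of_nonneg (hb.mass_pos Δ (Finset.subset_univ _))
    (Finset.sum_nonneg fun v _ => hb.nonneg Δ (Finset.subset_univ _) v (Finset.mem_univ v))

/-- Finiteness gives a uniform lower bound for the `w Δ`-measure of the edges shared with another
triangle. -/
theorem IsBalanced.exists_le_mass_mul (hb : IsBalanced a Finset.univ M w)
    (hpos : IsPositiveOnNonsimpleEdges a) :
    ∃ κ > 0, ∀ Δ Δ' : Triangle G, Δ' ≠ Δ → ∀ p q, p ≠ q → p ∈ Δ.1 → q ∈ Δ.1 → p ∈ Δ'.1 →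
      q ∈ Δ'.1 → κ ≤ M Δ * (a Δ p + a Δ q) := by
  classical
  let F : Triangle G × V × V → ℝ := fun i => M i.1 * (a i.1 i.2.1 + a i.1 i.2.2)
  let T : Finset (Triangle G × V × V) := Finset.univ.filter fun i => 0 < F i
  have hT : ∀ Δ Δ' : Triangle G, Δ' ≠ Δ → ∀ p q, p ≠ q → p ∈ Δ.1 → q ∈ Δ.1 → p ∈ Δ'.1 →
      q ∈ Δ'.1 → (Δ, p, q) ∈ T := fun Δ Δ' hne p q hpq hp hq hp' hq' =>
    Finset.mem_filter.2 ⟨Finset.mem_univ _, mul_pos (hb.mass_pos Δ (Finset.subset_univ _))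
      (hpos Δ p hp q hq hpq ⟨Δ', hne, hp', hq'⟩)⟩
  rcases T.eq_empty_or_nonempty with h | h
  · refine ⟨1, one_pos, fun Δ Δ' hne p q hpq hp hq hp' hq' => ?_⟩
    have := hT Δ Δ' hne p q hpq hp hq hp' hq'
    simp [h] at this
  · obtain ⟨i, hi, hmin⟩ := T.exists_min_image F h
    exact ⟨F i, (Finset.mem_filter.1 hi).2, fun Δ Δ' hne p q hpq hp hq hp' hq' =>
      hmin _ (hT Δ Δ' hne p q hpq hp hq hp' hq')⟩

end Step

/-! ### Convergence along an exhaustive walk -/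

section Walk

variable [Fintype V] {G : SimpleGraph V} {a : Triangle G → V → ℝ}
  {M : Triangle G → ℝ} {w : Triangle G → V → ℝ} {γ : ℕ → Triangle G} {x : ℕ → V → ℝ}

theorem IsBalanced.sum_walk (hb : IsBalanced a Finset.univ M w)
    (hγ : IsInfiniteWalk (derivedGraph G) γ) (t : ℕ) :
    ∑ v, w (γ t) v = ∑ v, w (γ 0) v := by
  induction t with
  | zero => rfl
  | succ t ih =>
    obtain ⟨-, p, q, hpq, hp, hq, hp', hq'⟩ := hγ t
    have := hb.sum_mul_eq_of_edge hpq.ne hp hq hp' hq' (f := 1) rfl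
    simp only [Pi.one_apply, mul_one] at this
    rw [← ih, this]

variable [DecidableEq V]

theorem mem_Icc_of_le (ha : IsLocalWeight a)
    (hx : ∀ t, x (t + 1) = (localMatrix a (γ t)).mulVec (x t)) {s : ℕ} {l u : ℝ}
    (hs : ∀ v, l ≤ x s v ∧ x s v ≤ u) {t : ℕ} (hst : s ≤ t) (v : V) : l ≤ x t v ∧ x t v ≤ u := by
  induction t, hst using Nat.le_induction generalizing v with
  | base => exact hs v
  | succ t _ ih =>
    rw [hx]
    exact ha.mulVec_mem_Icc _ ih v

/-- The integral of the state under the measure of the current triangle is conserved. -/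
theorem IsBalanced.sum_mul_walk (hb : IsBalanced a Finset.univ M w) (ha : IsLocalWeight a)
    (hγ : IsInfiniteWalk (derivedGraph G) γ)
    (hx : ∀ t, x (t + 1) = (localMatrix a (γ t)).mulVec (x t)) (t : ℕ) :
    ∑ v, w (γ t) v * x t v = ∑ v, w (γ 0) v * x 0 v := by
  induction t with
  | zero => rfl
  | succ t ih =>
    obtain ⟨-, p, q, hpq, hp, hq, hp', hq'⟩ := hγ t
    rw [← ih, ← hb.sum_mul_mulVec ha (γ t), ← hx]
    refine (hb.sum_mul_eq_of_edge hpq.ne hp hq hp' hq' ?_).symm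
    rw [hx, localMatrix_mulVec_of_mem hp, localMatrix_mulVec_of_mem hq]

/-- The consecutive local means along the walk are asymptotically close: the square of each step is
bounded by the loss of energy, and the energy, the second moment of the state under the measure of
the current triangle, is nonnegative and decreasing. -/
theorem IsBalanced.eventually_abs_sub_le (hb : IsBalanced a Finset.univ M w) (ha : IsLocalWeight a)
    (hpos : IsPositiveOnNonsimpleEdges a) (hγ : IsInfiniteWalk (derivedGraph G) γ)
    (hx : ∀ t, x (t + 1) = (localMatrix a (γ t)).mulVec (x t)) {δ : ℝ} (hδ : 0 < δ) :
    ∀ᶠ t in atTop, |∑ v ∈ (γ (t + 1)).1, a (γ (t + 1)) v * x (t + 1) v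
      - ∑ v ∈ (γ t).1, a (γ t) v * x t v| ≤ δ := by
  obtain ⟨κ, hκ, hle⟩ := hb.exists_le_mass_mul hpos
  set r : ℕ → ℝ := fun t => ∑ v ∈ (γ t).1, a (γ t) v * x t v with hr
  let E : ℕ → ℝ := fun t => ∑ v, w (γ t) v * x t v ^ 2
  have hxr : ∀ t, ∀ v ∈ (γ t).1, x (t + 1) v = r t := fun t v hv => by
    rw [hx, localMatrix_mulVec_of_mem hv]
  have hE : ∀ t, E t - E (t + 1) =
      M (γ t) * (∑ v ∈ (γ t).1, a (γ t) v * x t v ^ 2 - r t ^ 2) := fun t => by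
    obtain ⟨-, p, q, hpq, hp, hq, hp', hq'⟩ := hγ t
    rw [← hb.sum_mul_mulVec_sq ha, ← hx]
    congr 1
    refine (hb.sum_mul_eq_of_edge hpq.ne hp hq hp' hq' ?_).symm
    rw [hxr t p hp, hxr t q hq]
  have hstep : ∀ t, κ * (r (t + 1) - r t) ^ 2 ≤ E (t + 1) - E (t + 2) := fun t => by
    obtain ⟨hne, p, q, hpq, hp, hq, hp', hq'⟩ := hγ t
    have h1 := ha.mul_sq_le_variance hp' hq' hpq.ne (hxr t p hp) (hxr t q hq)
    rw [hE (t + 1)]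
    calc κ * (r (t + 1) - r t) ^ 2
        ≤ M (γ (t + 1)) * (a (γ (t + 1)) p + a (γ (t + 1)) q) * (r (t + 1) - r t) ^ 2 :=
          mul_le_mul_of_nonneg_right (hle _ _ hne p q hpq.ne hp' hq' hp hq) (sq_nonneg _)
      _ = M (γ (t + 1)) * ((a (γ (t + 1)) p + a (γ (t + 1)) q) * (r (t + 1) - r t) ^ 2) :=
          mul_assoc _ _ _
      _ ≤ _ := mul_le_mul_of_nonneg_left h1 (hb.mass_pos _ (Finset.subset_univ _)).le
  have hanti : Antitone fun t => E (t + 1) := antitone_nat_of_succ_le fun t => by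
    have := mul_nonneg hκ.le (sq_nonneg (r (t + 1) - r t))
    linarith [hstep t]
  have hbdd : BddBelow (Set.range fun t => E (t + 1)) := ⟨0, by
    rintro _ ⟨t, rfl⟩
    exact Finset.sum_nonneg fun v _ => mul_nonneg
      (hb.nonneg _ (Finset.subset_univ _) v (Finset.mem_univ v)) (sq_nonneg _)⟩
  have hlim := tendsto_atTop_ciInf hanti hbdd
  have hdiff : Tendsto (fun t => E (t + 1) - E (t + 2)) atTop (𝓝 0) := by
    simpa using hlim.sub ((tendsto_add_atTop_iff_nat 1).2 hlim)
  filter_upwards [hdiff.eventually (gt_mem_nhds (show 0 < κ * δ ^ 2 by positivity))] with t ht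
  exact abs_le_of_sq_le_sq (le_of_mul_le_mul_left ((hstep t).trans ht.le) hκ) hδ.le

/-- From a time `s` on, let consecutive local means differ by at most `δ`. The values at the
vertices visited since then lie in an interval which has to grow only when a new vertex is visited,
and then by at most `δ` at each end. -/
theorem exists_forall_visited_mem_Icc (ha : IsLocalWeight a)
    (hx : ∀ t, x (t + 1) = (localMatrix a (γ t)).mulVec (x t)) {s : ℕ} {δ : ℝ} (hδ : 0 ≤ δ)
    (hs : ∀ t, s ≤ t → |∑ v ∈ (γ (t + 1)).1, a (γ (t + 1)) v * x (t + 1) v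
      - ∑ v ∈ (γ t).1, a (γ t) v * x t v| ≤ δ) (k : ℕ) :
    ∃ l : ℝ, ∀ v ∈ (Finset.range (k + 1)).biUnion fun i => (γ (s + i)).1,
      l ≤ x (s + k + 1) v ∧ x (s + k + 1) v ≤
        l + 2 * ((Finset.range (k + 1)).biUnion fun i => (γ (s + i)).1).card * δ := by
  have hxr : ∀ t, ∀ v ∈ (γ t).1, x (t + 1) v = ∑ v ∈ (γ t).1, a (γ t) v * x t v :=
    fun t v hv => by rw [hx, localMatrix_mulVec_of_mem hv]
  induction k with
  | zero =>
    refine ⟨∑ v ∈ (γ s).1, a (γ s) v * x s v, fun v hv => ?_⟩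
    rw [Finset.mem_biUnion] at hv
    obtain ⟨i, hi, hv⟩ := hv
    obtain rfl : i = 0 := by simpa using hi
    rw [add_zero, hxr s v hv]
    exact ⟨le_rfl, le_add_of_nonneg_right (by positivity)⟩
  | succ k ih =>
    obtain ⟨l, hl⟩ := ih
    set U : ℕ → Finset V := fun k => (Finset.range (k + 1)).biUnion fun i => (γ (s + i)).1 with hU
    change ∀ v ∈ U k, l ≤ x (s + k + 1) v ∧ x (s + k + 1) v ≤ l + 2 * (U k).card * δ at hl
    change ∃ l : ℝ, ∀ v ∈ U (k + 1), l ≤ x (s + k + 1 + 1) v ∧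
      x (s + k + 1 + 1) v ≤ l + 2 * (U (k + 1)).card * δ
    have hUsucc : U (k + 1) = (γ (s + k + 1)).1 ∪ U k := by
      simp only [hU]
      rw [Finset.range_add_one, Finset.biUnion_insert, add_assoc]
    by_cases hsub : (γ (s + k + 1)).1 ⊆ U k
    · rw [Finset.union_eq_right.2 hsub] at hUsucc
      rw [hUsucc]
      refine ⟨l, fun v hv => ?_⟩
      rw [hx]
      by_cases hvΔ : v ∈ (γ (s + k + 1)).1
      · rw [localMatrix_mulVec_of_mem hvΔ]
        exact ha.mem_Icc _ fun u hu => hl u (hsub hu)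
      · rw [localMatrix_mulVec_of_notMem hvΔ]
        exact hl v hv
    · have hcard : (U k).card + 1 ≤ (U (k + 1)).card := by
        rw [hUsucc]
        refine Finset.card_lt_card ((Finset.ssubset_iff_of_subset Finset.subset_union_right).2 ?_)
        obtain ⟨z, hz, hz'⟩ := Finset.not_subset.1 hsub
        exact ⟨z, Finset.mem_union_left _ hz, hz'⟩
      have hcard' : ((U k).card : ℝ) + 1 ≤ (U (k + 1)).card := by exact_mod_cast hcard
      have hmul := mul_le_mul_of_nonneg_right hcard' hδ
      obtain ⟨p, hp⟩ : ∃ p, p ∈ (γ (s + k)).1 :=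
        Finset.card_pos.1 (by rw [(γ (s + k)).2.card_eq]; omega)
      have hpU : p ∈ U k := Finset.mem_biUnion.2 ⟨k, by simp, hp⟩
      have h1 := hl p hpU
      rw [hxr _ p hp] at h1
      have h2 := abs_le.1 (hs (s + k) (by omega))
      refine ⟨l - δ, fun v hv => ?_⟩
      by_cases hvΔ : v ∈ (γ (s + k + 1)).1
      · rw [hxr _ v hvΔ]
        constructor <;> linarith [h1.1, h1.2, h2.1, h2.2]
      · have hvU : v ∈ U k := (Finset.mem_union.1 (hUsucc ▸ hv)).resolve_left hvΔ
        rw [hx, localMatrix_mulVec_of_notMem hvΔ]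
        have h3 := hl v hvU
        constructor <;> linarith [h3.1, h3.2]

/-- Along an exhaustive walk, every state converges to the constant vector given by its mean under
the measure of the first triangle. -/
theorem IsBalanced.tendsto_walk (hb : IsBalanced a Finset.univ M w) (ha : IsLocalWeight a)
    (hpos : IsPositiveOnNonsimpleEdges a) (hcover : ∀ v, ∃ Δ : Triangle G, v ∈ Δ.1)
    (hγ : IsInfiniteWalk (derivedGraph G) γ) (hex : IsExhaustive γ)
    (hx : ∀ t, x (t + 1) = (localMatrix a (γ t)).mulVec (x t)) (v : V) :
    Tendsto (fun t => x t v) atTop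
      (𝓝 ((∑ u, w (γ 0) u * x 0 u) / ∑ u, w (γ 0) u)) := by
  set c := (∑ u, w (γ 0) u * x 0 u) / ∑ u, w (γ 0) u with hc
  have hS := hb.sum_pos ha (γ 0)
  rw [Metric.tendsto_atTop]
  intro ε hε
  set δ : ℝ := ε / (2 * Fintype.card V + 1) with hδ
  have hδ0 : 0 < δ := by positivity
  obtain ⟨s, hs⟩ := eventually_atTop.1 (hb.eventually_abs_sub_le ha hpos hγ hx hδ0)
  have hvisit : ∀ u, ∃ i, u ∈ (γ (s + i)).1 := fun u => by
    obtain ⟨Δ, hΔ⟩ := hcover u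
    obtain ⟨t, hst, rfl⟩ := frequently_atTop.1 (hex Δ) s
    exact ⟨t - s, by rwa [Nat.add_sub_cancel' hst]⟩
  choose i hi using hvisit
  obtain ⟨l, hl⟩ := exists_forall_visited_mem_Icc ha hx hδ0.le hs (Finset.univ.sup i)
  have huniv : ((Finset.range (Finset.univ.sup i + 1)).biUnion fun j => (γ (s + j)).1)
      = Finset.univ := by
    refine Finset.eq_univ_iff_forall.2 fun u => Finset.mem_biUnion.2 ⟨i u, ?_, hi u⟩
    exact Finset.mem_range.2 (Nat.lt_succ_of_le (Finset.le_sup (Finset.mem_univ u)))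
  rw [huniv, Finset.card_univ] at hl
  set u := l + 2 * Fintype.card V * δ with hu
  refine ⟨s + Finset.univ.sup i + 1, fun t ht => ?_⟩
  have hxt := mem_Icc_of_le ha hx (fun v => hl v (Finset.mem_univ v)) ht
  have hmean : ∑ z, w (γ t) z * x t z = c * ∑ z, w (γ t) z := by
    rw [hb.sum_mul_walk ha hγ hx t, hb.sum_walk hγ t, hc, div_mul_cancel₀ _ hS.ne']
  have hSt := hb.sum_pos ha (γ t)
  have hw : ∀ z, 0 ≤ w (γ t) z := fun z =>
    hb.nonneg _ (Finset.subset_univ _) z (Finset.mem_univ z)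
  have hlc : l ≤ c := by
    refine le_of_mul_le_mul_right ?_ hSt
    rw [← hmean, Finset.mul_sum]
    refine Finset.sum_le_sum fun z _ => ?_
    rw [mul_comm]
    exact mul_le_mul_of_nonneg_left (hxt z).1 (hw z)
  have hcu : c ≤ u := by
    refine le_of_mul_le_mul_right ?_ hSt
    rw [← hmean, Finset.mul_sum]
    refine Finset.sum_le_sum fun z _ => ?_
    rw [mul_comm u]
    exact mul_le_mul_of_nonneg_left (hxt z).2 (hw z)
  have hwidth : 2 * Fintype.card V * δ < ε := by
    have : (2 * Fintype.card V + 1) * δ = ε := by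
      rw [hδ]
      field_simp
    linarith
  rw [Real.dist_eq, abs_lt]
  constructor <;> linarith [(hxt v).1, (hxt v).2]

end Walk

end TLG

theorem theorem3 {V : Type*} [Fintype V] [DecidableEq V] (G : SimpleGraph V)
    (hn : 2 ≤ Fintype.card V) (hG : TLG.IsTriangulatedLaman G)
    (a : TLG.Triangle G → V → ℝ) (ha : TLG.IsLocalWeight a)
    (hpos : TLG.IsPositiveOnNonsimpleEdges a) :
    Nat.card (TLG.Triangle G) = Fintype.card V - 2 ∧
    ∃ w : TLG.Triangle G → V → ℝ,
      (∀ Δ, w Δ ∈ stdSimplex ℝ V) ∧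
      ∀ γ : ℕ → TLG.Triangle G,
        TLG.IsInfiniteWalk (TLG.derivedGraph G) γ → TLG.IsExhaustive γ →
        Tendsto (TLG.partialProduct (TLG.localMatrix a) γ) atTop
          (𝓝 (Matrix.vecMulVec (fun _ => (1 : ℝ)) (w (γ 0)))) := by
  have htree := hG.isTwoTree hn
  refine ⟨?_, ?_⟩
  · have h := htree.card_triangle
    rw [Nat.card_congr (Equiv.subtypeUnivEquiv fun Δ => Finset.subset_univ _),
      Finset.card_univ] at h
    omega
  obtain ⟨M, w, hb⟩ := htree.exists_isBalanced ha hpos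
  refine ⟨fun Δ v => w Δ v / ∑ u, w Δ u, fun Δ => ⟨fun v => ?_, ?_⟩, fun γ hγ hex => ?_⟩
  · exact div_nonneg (hb.nonneg Δ (Finset.subset_univ _) v (Finset.mem_univ v))
      (hb.sum_pos ha Δ).le
  · rw [← Finset.sum_div, div_self (hb.sum_pos ha Δ).ne']
  have h3 : 3 ≤ (Finset.univ : Finset V).card :=
    (γ 0).2.card_eq ▸ Finset.card_le_card (Finset.subset_univ _)
  have hcover := fun v => htree.exists_triangle_mem h3 v (Finset.mem_univ v)
  refine tendsto_pi_nhds.2 fun i => tendsto_pi_nhds.2 fun j => ?_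
  -- The columns of the partial products are the states that start at the standard basis vectors.
  have h := hb.tendsto_walk ha hpos hcover hγ hex
    (x := fun t v => TLG.partialProduct (TLG.localMatrix a) γ t v j)
    (fun t => by
      funext v
      simp [TLG.partialProduct, Matrix.mul_apply, Matrix.mulVec, dotProduct]) i
  simpa [TLG.partialProduct, Matrix.one_apply, Matrix.vecMulVec_apply] using h
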